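/- Fix $d \ge 1$ and pairwise distinct integers $r_1, \ldots, r_d \ge 2$. For each $n$, let $V_n$ be a finite set and let $\boldsymbol{H}_n = (H_n^{(1)}, \ldots, H_n^{(d)})$ be a $d$-tuple of hypergraphs on the common vertex set $V_n$, where $H_n^{(i)}$ is $r_i$-uniform (every hyperedge is a set of exactly $r_i$ vertices) for $1 \le i \le d$. Suppose that the vertices in $V_n$ are colored independently and uniformly at random with $c_n$ colors, where $c_n \to \infty$, and let $T(H_n^{(i)})$ denote the number of hyperedges $e \in E(H_n^{(i)})$ that are monochromatic, that is, all of whose vertices have the same color. Suppose that for each $1 \le i \le d$ there is a constant $\lambda_i \ge 0$ such that $$\lim_{n \to \infty} \mathbb{E}\, T(H_n^{(i)}) = \lim_{n \to \infty} \mathrm{Var}\, T(H_n^{(i)}) = \lambda_i .$$ Then, as $n \to \infty$, $$\big(T(H_n^{(1)}), \ldots, T(H_n^{(d)})\big) \xrightarrow{\;D\;} (Z_1, \ldots, Z_d)$$ in distribution, where $Z_1 \sim \mathrm{Pois}(\lambda_1), \ldots, Z_d \sim \mathrm{Pois}(\lambda_d)$ are independent and $\mathrm{Pois}(0)$ is the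 point mass at $0$. -/

import Mathlib

open MeasureTheory ProbabilityTheory Filter Topology
open scoped NNReal

/-- A hypergraph is `r`-uniform if each of its hyperedges has exactly `r` vertices. -/
def Hypergraph.IsUniform {V : Type*} (H : Hypergraph V) (r : ℕ) : Prop :=
  ∀ e ∈ H.edgeSet, e.encard = r

/-- A `d`-hypermultiplex on the vertex set `V`: hypergraphs `layer 0, …, layer (d - 1)` with the
common vertex set `V`, the `i`-th of which is `r i`-uniform. -/
structure Hypermultiplex (V : Type*) {d : ℕ} (r : Fin d → ℕ) where
  layer : Fin d → Hypergraph V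
  vertexSet_layer : ∀ i, (layer i).vertexSet = Set.univ
  isUniform_layer : ∀ i, (layer i).IsUniform (r i)

/-- A set of vertices is monochromatic under the coloring `x` if all its vertices have the same
color. -/
def IsMonochromatic {V C : Type*} (x : V → C) (e : Set V) : Prop :=
  ∀ v ∈ e, ∀ v' ∈ e, x v = x v'

/-- The number of monochromatic hyperedges of `H` under the vertex coloring `x`. -/
noncomputable def monochromaticCount {V C : Type*} (H : Hypergraph V) (x : V → C) : ℕ :=
  {e ∈ H.edgeSet | IsMonochromatic x e}.ncard

/-- The family `X` of random variables is a uniformly random coloring of `V` with `c` colors: the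
colors `X v` of the vertices are independent, and each is uniformly distributed on the `c`
colors. -/
structure IsUniformRandomColoring {V Ω : Type*} [MeasurableSpace Ω] {c : ℕ}
    (X : V → Ω → Fin c) (P : Measure Ω) : Prop where
  measurable : ∀ v, Measurable (X v)
  iIndepFun : iIndepFun X P
  uniform : ∀ v a, P.real {ω | X v ω = a} = 1 / (c : ℝ)

/-! ### Uniform colorings: conditioning on a monochromatic edge. -/

section Colorings

open scoped BigOperators
open Finset

variable {V : Type*} [DecidableEq V]

/-! Write `q = 1 / c` and let `T` be the vector of counts. Independent Poisson laws are
characterized by the recursion `(k j + 1) P(T = k + e_j) = λ_j P(T = k)`, and the proof shows that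
`T` satisfies it asymptotically.

On `{T = k + e_j}` the factor `k j + 1` is the number of monochromatic edges of layer `j`, so the
left side is a sum over these edges `e`. Conditioning on `e` being monochromatic amounts to
recoloring `e` with the color of one of its vertices `v₀ e` (`expect_monoInd_mul`). This raises `T`
by exactly `e_j`, unless `e` was already monochromatic or some other edge meeting `e` outside `v₀ e`
is monochromatic before or after (`abs_countProb_recursion_le`).

Two kinds of error need an idea. Edges sharing at least two vertices with `e` are measured by
`overlapSum`: inside a layer, equality of the limits of mean and variance makes it vanish
(`overlapSum_le_variance`); across layers, Cauchy–Schwarz over the common vertex set and the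
distinctness of the `r i` do (`overlapSum_sq_le_of_lt`). For edges sharing a single vertex, `v₀ e`
is chosen of maximal weighted degree in `e`, so that only the smaller degrees enter
(`sum_sum_erase_sq_le`).

The recursion and Markov tightness give asymptotic lower bounds for all point masses
(`eventually_poisson_le_of_recursion`). These suffice for convergence in distribution, by the
open-set form of the portmanteau theorem. -/

open Classical in
/-- The indicator of the event that `e` is monochromatic under `x`. -/
noncomputable def monoInd {V C : Type*} (x : V → C) (e : Finset V) : ℝ :=
  if IsMonochromatic x (e : Set V) then 1 else 0

/-- Recolor all vertices of `e` with the color of the vertex `v₀`. -/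
def recolor {V C : Type*} [DecidableEq V] (e : Finset V) (v₀ : V) (x : V → C) : V → C :=
  fun v => if v ∈ e then x v₀ else x v

lemma monoInd_nonneg {V C : Type*} (x : V → C) (e : Finset V) : 0 ≤ monoInd x e := by
  unfold monoInd; split_ifs <;> norm_num

lemma monoInd_eq_zero_or_one {V C : Type*} (x : V → C) (e : Finset V) :
    monoInd x e = 0 ∨ monoInd x e = 1 := by
  unfold monoInd; split_ifs <;> simp

lemma monoInd_congr {V C : Type*} {x y : V → C} {e : Finset V} (h : ∀ v ∈ e, x v = y v) :
    monoInd x e = monoInd y e := by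
  have : IsMonochromatic x (e : Set V) ↔ IsMonochromatic y (e : Set V) := by
    unfold IsMonochromatic
    refine forall₂_congr fun v hv => forall₂_congr fun w hw => ?_
    rw [h v hv, h w hw]
  by_cases hy : IsMonochromatic y (e : Set V)
  · simp [monoInd, this.2 hy, hy]
  · simp [monoInd, mt this.1 hy, hy]

lemma recolor_eq_self {C : Type*} {e f : Finset V} {v₀ : V} (h : ∀ v ∈ e, v ∈ f → v = v₀)
    (x : V → C) : ∀ v ∈ f, recolor e v₀ x v = x v := by
  intro v hv
  unfold recolor
  split_ifs with hve
  · rw [h v hve hv]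
  · rfl

lemma isMonochromatic_recolor {C : Type*} (e : Finset V) (v₀ : V) (x : V → C) :
    IsMonochromatic (recolor e v₀ x) (e : Set V) := by
  intro v hv w hw
  have hv' : v ∈ e := hv
  have hw' : w ∈ e := hw
  simp [recolor, hv', hw']

lemma monoInd_recolor {C : Type*} (e : Finset V) (v₀ : V) (x : V → C) :
    monoInd (recolor e v₀ x) e = 1 := by
  simp [monoInd, isMonochromatic_recolor]

lemma monoInd_mul_monoInd {C : Type*} (x : V → C) {e f : Finset V} (h : (e ∩ f).Nonempty) :
    monoInd x e * monoInd x f = monoInd x (e ∪ f) := by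
  have : IsMonochromatic x ((e ∪ f : Finset V) : Set V) ↔
      IsMonochromatic x (e : Set V) ∧ IsMonochromatic x (f : Set V) := by
    constructor
    · intro H
      exact ⟨fun v hv w hw => H v (by simp_all) w (by simp_all),
        fun v hv w hw => H v (by simp_all) w (by simp_all)⟩
    · rintro ⟨He, Hf⟩
      obtain ⟨u, hu⟩ := h
      rw [mem_inter] at hu
      have : ∀ v ∈ ((e ∪ f : Finset V) : Set V), x v = x u := by
        intro v hv
        rw [mem_coe, mem_union] at hv
        rcases hv with hv | hv
        · exact He v hv u hu.1
        · exact Hf v hv u hu.2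
      exact fun v hv w hw => (this v hv).trans (this w hw).symm
  unfold monoInd
  by_cases h1 : IsMonochromatic x (e : Set V) <;>
  by_cases h2 : IsMonochromatic x (f : Set V) <;> simp [this, h1, h2, -coe_union]

variable [Fintype V] {c : ℕ}

/-- A preimage of `y` is free on `e` minus `v₀` and agrees with `y` elsewhere. -/
lemma card_recolor_fiber {e : Finset V} {v₀ : V} (hv₀ : v₀ ∈ e) {y : V → Fin c}
    (hy : IsMonochromatic y (e : Set V)) :
    #{x : V → Fin c | recolor e v₀ x = y} = c ^ (#e - 1) := by
  have : ({x : V → Fin c | recolor e v₀ x = y} : Finset _) =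
      Fintype.piFinset (fun v => if v ∈ e.erase v₀ then univ else {y v}) := by
    ext x
    simp only [mem_filter, mem_univ, true_and, Fintype.mem_piFinset]
    constructor
    · rintro h v
      split_ifs with hv
      · simp
      · rw [← h, mem_singleton, recolor]
        split_ifs with hve
        · have : v = v₀ := by by_contra hne; exact hv (mem_erase.2 ⟨hne, hve⟩)
          rw [this]
        · rfl
    · intro h
      funext v
      have h0 : x v₀ = y v₀ := by simpa using h v₀
      unfold recolor
      split_ifs with hve
      · rw [h0]; exact hy v₀ hv₀ v hve
      · simpa [hve] using h v
  rw [this, Fintype.card_piFinset]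
  have hc : ∀ v, #(if v ∈ e.erase v₀ then (univ : Finset (Fin c)) else {y v}) =
      if v ∈ e.erase v₀ then c else 1 := by
    intro v; split_ifs <;> simp
  simp_rw [hc]
  rw [Finset.prod_ite_mem, univ_inter, prod_const, card_erase_of_mem hv₀]

/-- Conditioning on the event that `e` is monochromatic amounts to recoloring `e`. -/
lemma expect_monoInd_mul [NeZero c] {e : Finset V} {v₀ : V} (hv₀ : v₀ ∈ e)
    (g : (V → Fin c) → ℝ) :
    𝔼 x, monoInd x e * g x = ((c : ℝ)⁻¹) ^ (#e - 1) * 𝔼 x, g (recolor e v₀ x) := by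
  have hc : (c : ℝ) ≠ 0 := Nat.cast_ne_zero.2 (NeZero.ne c)
  have key : ∑ x : V → Fin c, g (recolor e v₀ x) =
      (c : ℝ) ^ (#e - 1) * ∑ x : V → Fin c, monoInd x e * g x := by
    rw [← Finset.sum_fiberwise (s := univ) (g := fun x : V → Fin c => recolor e v₀ x), mul_sum]
    refine sum_congr rfl fun y _ => ?_
    by_cases hy : IsMonochromatic y (e : Set V)
    · rw [sum_congr rfl (g := fun _ => g y)
        (fun x hx => by rw [(mem_filter.1 hx).2]), sum_const, card_recolor_fiber hv₀ hy]
      simp [monoInd, hy]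
    · rw [filter_false_of_mem]
      · simp [monoInd, hy]
      · rintro x - rfl
        exact hy (isMonochromatic_recolor e v₀ x)
  rw [Fintype.expect_eq_sum_div_card, Fintype.expect_eq_sum_div_card, key, inv_pow]
  field_simp

variable [NeZero c]

lemma expect_monoInd {e : Finset V} (he : e.Nonempty) :
    𝔼 x : V → Fin c, monoInd x e = ((c : ℝ)⁻¹) ^ (#e - 1) := by
  obtain ⟨v, hv⟩ := he
  simpa using expect_monoInd_mul hv (fun _ : V → Fin c => 1)

lemma expect_monoInd_mul_monoInd {e f : Finset V} (h : (e ∩ f).Nonempty) :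
    𝔼 x : V → Fin c, monoInd x e * monoInd x f = ((c : ℝ)⁻¹) ^ (#(e ∪ f) - 1) := by
  simp_rw [monoInd_mul_monoInd _ h]
  exact expect_monoInd (h.mono (inter_subset_union))

/-- Recoloring `e` from the common vertex, or from any vertex if there is none, does not change the
colors on `f`; hence the two events are independent. -/
lemma expect_monoInd_mul_monoInd_of_card_inter_le_one {e f : Finset V} (he : e.Nonempty)
    (hf : f.Nonempty) (h : #(e ∩ f) ≤ 1) :
    𝔼 x : V → Fin c, monoInd x e * monoInd x f =
      ((c : ℝ)⁻¹) ^ (#e - 1) * ((c : ℝ)⁻¹) ^ (#f - 1) := by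
  obtain ⟨v, hv, hvf⟩ : ∃ v ∈ e, ∀ w ∈ e, w ∈ f → w = v := by
    rcases (e ∩ f).eq_empty_or_nonempty with h0 | ⟨v, hv⟩
    · obtain ⟨v, hv⟩ := he
      refine ⟨v, hv, fun w hwe hwf => ?_⟩
      have : w ∈ e ∩ f := mem_inter.2 ⟨hwe, hwf⟩
      simp [h0] at this
    · exact ⟨v, (mem_inter.1 hv).1, fun w hwe hwf =>
        card_le_one.1 h w (mem_inter.2 ⟨hwe, hwf⟩) v hv⟩
  rw [expect_monoInd_mul hv (fun x => monoInd x f), ← expect_monoInd hf]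
  congr 1
  exact expect_congr rfl fun x _ => monoInd_congr (recolor_eq_self hvf x)

end Colorings

/-! ### Cauchy–Schwarz bounds for overlapping edges. -/

section Overlaps

open scoped BigOperators
open Finset

variable {V : Type*} [DecidableEq V]

/-- The sum of `q ^ (#(e ∪ f) - 1)` over all pairs of distinct edges `e ∈ E`, `f ∈ F` with at least
two common vertices. -/
noncomputable def overlapSum (q : ℝ) (E F : Finset (Finset V)) : ℝ :=
  ∑ e ∈ E, ∑ f ∈ F, if e ≠ f ∧ 2 ≤ #(e ∩ f) then q ^ (#(e ∪ f) - 1) else 0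

/-- The number of edges in `E` that contain `S`. -/
noncomputable def codegree (E : Finset (Finset V)) (S : Finset V) : ℝ :=
  ∑ e ∈ E, if S ⊆ e then 1 else 0

lemma overlapSum_nonneg {q : ℝ} (hq : 0 ≤ q) (E F : Finset (Finset V)) : 0 ≤ overlapSum q E F :=
  sum_nonneg fun _ _ => sum_nonneg fun _ _ => by split_ifs <;> positivity

lemma overlapSum_comm (q : ℝ) (E F : Finset (Finset V)) : overlapSum q E F = overlapSum q F E := by
  unfold overlapSum
  rw [sum_comm]
  refine sum_congr rfl fun f _ => sum_congr rfl fun e _ => ?_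
  simp only [inter_comm e f, union_comm e f, ne_comm (a := e)]

variable {q : ℝ} {r s m : ℕ} {E F : Finset (Finset V)}

section

variable [Fintype V]

/-- Expanding the square gives pairs `(e, f)` with `S ⊆ e ∩ f`, at most `2 ^ r` sets `S` for each
pair. Off the diagonal `#S ≤ #(e ∩ f)` compares the exponent with that of `overlapSum`; on it `#S ≤
m` leaves the factor `q ^ (r - m)`, a gain when `m < r`. -/
lemma sum_codegree_sq_le (hq : 0 < q) (hq1 : q ≤ 1) (hE : ∀ e ∈ E, #e = r) (hm : m ≤ r) :
    ∑ S : Finset V with 2 ≤ #S ∧ #S ≤ m, q ^ (2 * r - #S - 1) * codegree E S ^ 2 ≤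
      2 ^ r * (#E * q ^ (r - 1) * q ^ (r - m) + overlapSum q E E) := by
  have h1 : ∀ S : Finset V, q ^ (2 * r - #S - 1) * codegree E S ^ 2 =
      ∑ e ∈ E, ∑ f ∈ E, if S ⊆ e ∧ S ⊆ f then q ^ (2 * r - #S - 1) else 0 := by
    intro S
    rw [codegree, sq, sum_mul_sum, mul_sum]
    refine sum_congr rfl fun e _ => ?_
    rw [mul_sum]
    refine sum_congr rfl fun f _ => ?_
    by_cases h1 : S ⊆ e <;> by_cases h2 : S ⊆ f <;> simp [h1, h2]
  have h2 : (#E : ℝ) * q ^ (r - 1) * q ^ (r - m) =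
      ∑ e ∈ E, ∑ f ∈ E, if e = f then q ^ (r - 1) * q ^ (r - m) else 0 := by
    rw [sum_congr rfl fun e he => (sum_ite_eq E e _).trans (if_pos he)]
    rw [sum_const, nsmul_eq_mul, mul_assoc]
  simp_rw [h1]
  rw [h2, overlapSum, ← sum_add_distrib, sum_comm, mul_sum]
  refine sum_le_sum fun e he => ?_
  rw [sum_comm, ← sum_add_distrib, mul_sum]
  refine sum_le_sum fun f hf => ?_
  have hcard : ∀ (B : ℝ), 0 ≤ B → (∀ S : Finset V, 2 ≤ #S → #S ≤ m → S ⊆ e → S ⊆ f →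
      q ^ (2 * r - #S - 1) ≤ B) → (∑ S : Finset V with 2 ≤ #S ∧ #S ≤ m,
      if S ⊆ e ∧ S ⊆ f then q ^ (2 * r - #S - 1) else 0) ≤ 2 ^ r * B := by
    intro B hB h
    rw [← sum_filter]
    refine (sum_le_card_nsmul _ _ B ?_).trans ?_
    · intro S hS
      simp only [mem_filter, mem_univ, true_and] at hS
      exact h S hS.1.1 hS.1.2 hS.2.1 hS.2.2
    · rw [nsmul_eq_mul]
      refine mul_le_mul_of_nonneg_right ?_ hB
      have : #(({S : Finset V | 2 ≤ #S ∧ #S ≤ m} : Finset _).filter fun S => S ⊆ e ∧ S ⊆ f) ≤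
          #e.powerset := card_le_card fun S hS => by
        simp only [mem_filter, mem_univ, true_and] at hS
        exact mem_powerset.2 hS.2.1
      rw [card_powerset, hE e he] at this
      exact_mod_cast this
  have hu := card_union_add_card_inter e f
  rw [hE e he, hE f hf] at hu
  refine hcard _ (by split_ifs <;> positivity) fun S hS2 hSm hSe hSf => ?_
  by_cases hef : e = f
  · simp only [hef, if_true, ne_eq, not_true_eq_false, false_and, if_false, add_zero, ← pow_add]
    exact pow_le_pow_of_le_one hq.le hq1 (by omega)
  · have h3 := card_le_card (subset_inter hSe hSf)
    have h4 : 2 ≤ #(e ∩ f) := by omega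
    simp only [hef, ne_eq, not_false_eq_true, h4, and_self, if_true, if_false, zero_add]
    exact pow_le_pow_of_le_one hq.le hq1 (by omega)

/-- Each overlapping pair is charged to `S = e ∩ f`. The weight `q ^ (r + s - #S - 1)` is the
geometric mean of the two weights on the right, so Cauchy–Schwarz over `S` separates the layers. -/
lemma overlapSum_sq_le (hq : 0 < q) (hE : ∀ e ∈ E, #e = r)
    (hF : ∀ f ∈ F, #f = s) (hrs : r ≤ s) :
    overlapSum q E F ^ 2 ≤
      (∑ S : Finset V with 2 ≤ #S ∧ #S ≤ r, q ^ (2 * r - #S - 1) * codegree E S ^ 2) *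
      ∑ S : Finset V with 2 ≤ #S ∧ #S ≤ r, q ^ (2 * s - #S - 1) * codegree F S ^ 2 := by
  have h1 : overlapSum q E F ≤ ∑ S : Finset V with 2 ≤ #S ∧ #S ≤ r,
      q ^ (r + s - #S - 1) * (codegree E S * codegree F S) := by
    have h1 : ∀ S : Finset V, q ^ (r + s - #S - 1) * (codegree E S * codegree F S) =
        ∑ e ∈ E, ∑ f ∈ F, if S ⊆ e ∧ S ⊆ f then q ^ (r + s - #S - 1) else 0 := by
      intro S
      rw [codegree, codegree, sum_mul_sum, mul_sum]
      refine sum_congr rfl fun e _ => ?_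
      rw [mul_sum]
      refine sum_congr rfl fun f _ => ?_
      by_cases h1 : S ⊆ e <;> by_cases h2 : S ⊆ f <;> simp [h1, h2]
    simp_rw [h1]
    rw [sum_comm]
    refine sum_le_sum fun e he => ?_
    rw [sum_comm]
    refine sum_le_sum fun f hf => ?_
    have hnn : ∀ S ∈ ({S : Finset V | 2 ≤ #S ∧ #S ≤ r} : Finset _),
        0 ≤ if S ⊆ e ∧ S ⊆ f then q ^ (r + s - #S - 1) else 0 := fun S _ => by
      split_ifs <;> positivity
    split_ifs with h
    · have hu := card_union_add_card_inter e f
      rw [hE e he, hF f hf] at hu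
      have hmem : e ∩ f ∈ ({S : Finset V | 2 ≤ #S ∧ #S ≤ r} : Finset _) := by
        simp only [mem_filter, mem_univ, true_and]
        exact ⟨h.2, hE e he ▸ card_le_card inter_subset_left⟩
      refine le_trans (le_of_eq ?_) (single_le_sum hnn hmem)
      rw [if_pos ⟨inter_subset_left, inter_subset_right⟩]
      congr 1
      omega
    · exact sum_nonneg hnn
  refine (pow_le_pow_left₀ (overlapSum_nonneg hq.le _ _) h1 2).trans ?_
  refine sum_sq_le_sum_mul_sum_of_sq_le_mul _ (fun S _ => by positivity)
    (fun S _ => by positivity) fun S hS => ?_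
  simp only [mem_filter, mem_univ, true_and] at hS
  have : q ^ (2 * r - #S - 1) * q ^ (2 * s - #S - 1) = (q ^ (r + s - #S - 1)) ^ 2 := by
    rw [← pow_add, ← pow_mul]
    congr 1
    omega
  rw [mul_pow, mul_pow, ← this]
  exact le_of_eq (by ring)

end

section

variable [Fintype V]

/-- If `D` attains its maximum over each edge `e` at `v₀ e`, the sum of the other values of `D` on
the edges is controlled by the pairs of overlapping edges. -/
lemma sum_sum_erase_sq_le (hq : 0 < q) (hq1 : q ≤ 1) (hr : 2 ≤ r) (hE : ∀ e ∈ E, #e = r)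
    (D : V → ℝ) (hD : ∀ v, 0 ≤ D v) (v₀ : Finset V → V) (hv₀ : ∀ e ∈ E, v₀ e ∈ e)
    (hmax : ∀ e ∈ E, ∀ v ∈ e, D v ≤ D (v₀ e)) :
    (q ^ (r - 1) * ∑ e ∈ E, ∑ v ∈ e.erase (v₀ e), D v) ^ 2 ≤
      r ^ 2 * q * (#E * q ^ (r - 1) + overlapSum q E E) * (∑ v, D v) ^ 2 := by
  -- Maximality gives `D v ≤ √(D (v₀ e)) * √(D v)`, one term of a sum over all ordered pairs in `e`
  -- that no longer mentions `v₀`.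
  have h1 : ∀ e ∈ E, ∑ v ∈ e.erase (v₀ e), D v ≤
      ∑ u, ∑ v, (if u ≠ v ∧ u ∈ e ∧ v ∈ e then 1 else 0) * (√(D u) * √(D v)) := by
    intro e he
    refine le_trans ?_ (single_le_sum (f := fun u => ∑ v, (if u ≠ v ∧ u ∈ e ∧ v ∈ e then 1 else 0) *
      (√(D u) * √(D v))) (fun u _ => sum_nonneg fun v _ => by positivity) (mem_univ (v₀ e)))
    refine le_trans ?_ (sum_le_sum_of_subset_of_nonneg (subset_univ (e.erase (v₀ e)))
      fun v _ _ => by positivity)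
    refine sum_le_sum fun v hv => ?_
    rw [mem_erase] at hv
    rw [if_pos ⟨hv.1.symm, hv₀ e he, hv.2⟩, one_mul]
    calc D v = √(D v) * √(D v) := (Real.mul_self_sqrt (hD v)).symm
      _ ≤ √(D (v₀ e)) * √(D v) := by
        gcongr
        exact hmax e he v hv.2
  -- The codegree of an ordered pair of distinct vertices; Cauchy–Schwarz over pairs separates it
  -- from `D`.
  let N : V × V → ℝ := fun p => ∑ e ∈ E, if p.1 ≠ p.2 ∧ p.1 ∈ e ∧ p.2 ∈ e then 1 else 0
  have h2 : q ^ (r - 1) * ∑ e ∈ E, ∑ v ∈ e.erase (v₀ e), D v ≤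
      ∑ p : V × V, (q ^ (r - 1) * N p) * (√(D p.1) * √(D p.2)) := by
    have : ∑ p : V × V, (q ^ (r - 1) * N p) * (√(D p.1) * √(D p.2)) =
        q ^ (r - 1) * ∑ e ∈ E, ∑ u, ∑ v,
          (if u ≠ v ∧ u ∈ e ∧ v ∈ e then 1 else 0) * (√(D u) * √(D v)) := by
      simp_rw [← Fintype.sum_prod_type' (f := fun u v =>
        (if u ≠ v ∧ u ∈ _ ∧ v ∈ _ then 1 else 0) * (√(D u) * √(D v)))]
      rw [sum_comm, mul_sum]
      refine sum_congr rfl fun p _ => ?_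
      rw [← sum_mul, mul_assoc]
    rw [this]
    gcongr with e he
    exact h1 e he
  have h3 : ∑ p : V × V, (√(D p.1) * √(D p.2)) ^ 2 = (∑ v, D v) ^ 2 := by
    rw [sq (∑ v, D v), sum_mul_sum, Fintype.sum_prod_type]
    refine sum_congr rfl fun u _ => sum_congr rfl fun v _ => ?_
    rw [mul_pow, Real.sq_sqrt (hD u), Real.sq_sqrt (hD v)]
  -- Only `e`, `f` with two common vertices contribute, with at most `r ^ 2` pairs `p`. The spare
  -- factor `q` comes from `#(e ∪ f) ≤ 2 * r - 2` off the diagonal and from `r ≤ 2 * r - 2` on it.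
  have h4 : ∑ p : V × V, (q ^ (r - 1) * N p) ^ 2 ≤
      r ^ 2 * q * (#E * q ^ (r - 1) + overlapSum q E E) := by
    have h5 : ∀ p : V × V, (q ^ (r - 1) * N p) ^ 2 = ∑ e ∈ E, ∑ f ∈ E,
        if p.1 ≠ p.2 ∧ p.1 ∈ e ∩ f ∧ p.2 ∈ e ∩ f then q ^ (2 * r - 2) else 0 := by
      intro p
      rw [mul_pow, sq (N p), sum_mul_sum, mul_sum]
      refine sum_congr rfl fun e _ => ?_
      rw [mul_sum]
      refine sum_congr rfl fun f _ => ?_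
      rw [← pow_mul, show (r - 1) * 2 = 2 * r - 2 by omega]
      simp only [mem_inter]
      by_cases h1 : p.1 ≠ p.2 ∧ p.1 ∈ e ∧ p.2 ∈ e
      · by_cases h2 : p.1 ≠ p.2 ∧ p.1 ∈ f ∧ p.2 ∈ f
        · rw [if_pos h1, if_pos h2, if_pos (by tauto)]; ring
        · rw [if_pos h1, if_neg h2, if_neg (by tauto)]; ring
      · rw [if_neg h1, zero_mul, mul_zero, if_neg (fun h => h1 ⟨h.1, h.2.1.1, h.2.2.1⟩)]
    simp_rw [h5]
    rw [sum_comm]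
    have h6 : (#E : ℝ) * q ^ (r - 1) = ∑ e ∈ E, ∑ f ∈ E, if e = f then q ^ (r - 1) else 0 := by
      rw [sum_congr rfl fun e he => (sum_ite_eq E e _).trans (if_pos he)]
      rw [sum_const, nsmul_eq_mul]
    rw [h6, overlapSum, ← sum_add_distrib, mul_sum]
    refine sum_le_sum fun e he => ?_
    rw [sum_comm, ← sum_add_distrib, mul_sum]
    refine sum_le_sum fun f hf => ?_
    rw [← sum_filter, sum_const, nsmul_eq_mul]
    have h7 : #({p : V × V | p.1 ≠ p.2 ∧ p.1 ∈ e ∩ f ∧ p.2 ∈ e ∩ f} : Finset _) ≤ r ^ 2 := by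
      rw [sq, ← hE e he, ← card_product]
      refine card_le_card fun p hp => ?_
      simp only [mem_filter, mem_univ, true_and, mem_inter] at hp
      exact mem_product.2 ⟨hp.2.1.1, hp.2.2.1⟩
    have h7' : (#({p : V × V | p.1 ≠ p.2 ∧ p.1 ∈ e ∩ f ∧ p.2 ∈ e ∩ f} : Finset _) : ℝ) ≤ r ^ 2 := by
      exact_mod_cast h7
    have hu := card_union_add_card_inter e f
    rw [hE e he, hE f hf] at hu
    by_cases hef : e = f
    · simp only [hef, if_true, ne_eq, not_true_eq_false, false_and, if_false, add_zero]
      rw [hef] at h7'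
      rw [mul_assoc, ← pow_succ']
      refine mul_le_mul h7' (pow_le_pow_of_le_one hq.le hq1 (by omega)) (by positivity)
        (by positivity)
    · simp only [hef, ne_eq, not_false_eq_true, if_false, zero_add, true_and]
      split_ifs with h8
      · rw [mul_assoc, ← pow_succ']
        refine mul_le_mul h7' (pow_le_pow_of_le_one hq.le hq1 (by omega)) (by positivity)
          (by positivity)
      · rw [filter_false_of_mem]
        · simp
        · rintro p - ⟨hp, hp1, hp2⟩
          exact hp (card_le_one.1 (by omega) _ hp1 _ hp2)
  have h0 : 0 ≤ q ^ (r - 1) * ∑ e ∈ E, ∑ v ∈ e.erase (v₀ e), D v :=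
    mul_nonneg (by positivity) (sum_nonneg fun _ _ => sum_nonneg fun v _ => hD v)
  refine (pow_le_pow_left₀ h0 h2 2).trans ((sum_mul_sq_le_sq_mul_sq _ _ _).trans ?_)
  rw [h3]
  gcongr

end

end Overlaps

/-! ### The approximate Poisson recursion for fixed layers. -/

section Recursion

open scoped BigOperators
open Finset


open Classical in
/-- The number of monochromatic edges in `E` under `x`. -/
noncomputable def monoCount {V C : Type*} (E : Finset (Finset V)) (x : V → C) : ℕ :=
  #(E.filter fun e : Finset V => IsMonochromatic x (e : Set V))

lemma cast_monoCount {V C : Type*} (E : Finset (Finset V)) (x : V → C) :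
    (monoCount E x : ℝ) = ∑ e ∈ E, monoInd x e := by
  simp only [monoCount, monoInd, sum_boole]

lemma nonempty_of_card_eq {V : Type*} {e : Finset V} {r : ℕ} (hr : 2 ≤ r) (he : #e = r) :
    e.Nonempty :=
  card_pos.1 (by omega)

variable {V : Type*} [DecidableEq V] [Fintype V] {c : ℕ} [NeZero c]

lemma expect_monoCount {E : Finset (Finset V)} {r : ℕ} (hr : 2 ≤ r) (hE : ∀ e ∈ E, #e = r) :
    𝔼 x : V → Fin c, (monoCount E x : ℝ) = #E * ((c : ℝ)⁻¹) ^ (r - 1) := by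
  simp_rw [cast_monoCount]
  rw [expect_sum_comm, sum_congr rfl (g := fun _ => ((c : ℝ)⁻¹) ^ (r - 1))]
  · simp
  · intro e he
    rw [expect_monoInd (nonempty_of_card_eq hr (hE e he)), hE e he]

lemma inv_natCast_pos_and_le_one (c : ℕ) [NeZero c] : 0 < (c : ℝ)⁻¹ ∧ (c : ℝ)⁻¹ ≤ 1 := by
  have : (1 : ℝ) ≤ c := by exact_mod_cast NeZero.one_le
  exact ⟨by positivity, inv_le_one_of_one_le₀ this⟩

/-- The variance is a sum of covariances over pairs of edges. They vanish for at most one common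
vertex, and the diagonal gives the mean term exactly. For larger overlaps `#(e ∪ f) ≤ 2 * r - 2`
bounds the product of the means by `q` times the joint probability. -/
lemma overlapSum_le_variance {E : Finset (Finset V)} {r : ℕ} (hr : 2 ≤ r)
    (hE : ∀ e ∈ E, #e = r) :
    (1 - (c : ℝ)⁻¹) * overlapSum (c : ℝ)⁻¹ E E +
        (1 - ((c : ℝ)⁻¹) ^ (r - 1)) * 𝔼 x : V → Fin c, (monoCount E x : ℝ) ≤
      𝔼 x : V → Fin c, (monoCount E x : ℝ) ^ 2 - (𝔼 x : V → Fin c, (monoCount E x : ℝ)) ^ 2 := by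
  obtain ⟨hq, hq1⟩ := inv_natCast_pos_and_le_one c
  rw [expect_monoCount hr hE]
  set q := (c : ℝ)⁻¹ with hqdef
  have h1 : 𝔼 x : V → Fin c, (monoCount E x : ℝ) ^ 2 =
      ∑ e ∈ E, ∑ f ∈ E, 𝔼 x : V → Fin c, monoInd x e * monoInd x f := by
    simp_rw [cast_monoCount, sq, sum_mul_sum]
    rw [expect_sum_comm]
    exact sum_congr rfl fun e _ => expect_sum_comm _ _ _
  have h2 : ((#E : ℝ) * q ^ (r - 1)) ^ 2 = ∑ e ∈ E, ∑ f ∈ E, q ^ (r - 1) * q ^ (r - 1) := by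
    simp only [sum_const, nsmul_eq_mul]
    ring
  have h3 : (1 - q ^ (r - 1)) * ((#E : ℝ) * q ^ (r - 1)) =
      ∑ e ∈ E, ∑ f ∈ E, if e = f then (1 - q ^ (r - 1)) * q ^ (r - 1) else 0 := by
    rw [sum_congr rfl fun e he => (sum_ite_eq E e _).trans (if_pos he)]
    rw [sum_const, nsmul_eq_mul]
    ring
  rw [h1, h2, h3, overlapSum, mul_sum, ← sum_add_distrib, ← sum_sub_distrib]
  refine sum_le_sum fun e he => ?_
  rw [mul_sum, ← sum_add_distrib, ← sum_sub_distrib]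
  refine sum_le_sum fun f hf => ?_
  have hne := nonempty_of_card_eq hr (hE e he)
  have hnf := nonempty_of_card_eq hr (hE f hf)
  have hu := card_union_add_card_inter e f
  rw [hE e he, hE f hf] at hu
  by_cases hef : e = f
  · subst hef
    rw [expect_monoInd_mul_monoInd (by simpa using hne)]
    simp only [union_self, hE e he, ne_eq, not_true_eq_false, false_and, if_false, if_true]
    exact le_of_eq (by ring)
  · by_cases h : 2 ≤ #(e ∩ f)
    · rw [expect_monoInd_mul_monoInd (card_pos.1 (by omega))]
      simp only [ne_eq, hef, not_false_eq_true, h, and_self, if_true, if_false]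
      have : q ^ (r - 1) * q ^ (r - 1) ≤ q * q ^ (#(e ∪ f) - 1) := by
        rw [← pow_add, ← pow_succ']
        exact pow_le_pow_of_le_one hq.le hq1 (by omega)
      linarith
    · rw [expect_monoInd_mul_monoInd_of_card_inter_le_one hne hnf (by omega), hE e he, hE f hf]
      simp [hef, h, hqdef]

section

variable {ι : Type*} [Fintype ι] [DecidableEq ι]

/-- The probability that the vector of the numbers of monochromatic edges in `E i` equals `k`. -/
noncomputable def countProb (c : ℕ) (E : ι → Finset (Finset V)) (k : ι → ℕ) : ℝ :=
  𝔼 x : V → Fin c, if (fun i => monoCount (E i) x) = k then 1 else 0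

variable {E : ι → Finset (Finset V)} {r : ι → ℕ}

-- Since the `r i` are distinct, `e` belongs to layer `j` only, so no other coordinate increases.
omit [Fintype V] [Fintype ι] in
lemma monoCount_recolor {C : Type*} (hr_inj : Function.Injective r) (hE : ∀ i, ∀ e ∈ E i, #e = r i)
    {j : ι} {e : Finset V} (he : e ∈ E j) {v₀ : V} {x : V → C} (hx : monoInd x e = 0)
    (h : ∀ i, ∀ f ∈ E i, f ≠ e → (¬ ∀ v ∈ e, v ∈ f → v = v₀) →
      monoInd x f = 0 ∧ monoInd (recolor e v₀ x) f = 0) :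
    (fun i => monoCount (E i) (recolor e v₀ x)) =
      (fun i => monoCount (E i) x) + Pi.single j 1 := by
  funext i
  have h1 : (monoCount (E i) (recolor e v₀ x) : ℝ) =
      monoCount (E i) x + ∑ f ∈ E i, if f = e then 1 else 0 := by
    rw [cast_monoCount, cast_monoCount, ← sum_add_distrib]
    refine sum_congr rfl fun f hf => ?_
    by_cases hfe : f = e
    · rw [hfe, hx, monoInd_recolor]
      simp
    · rw [if_neg hfe, add_zero]
      by_cases hb : ∀ v ∈ e, v ∈ f → v = v₀
      · exact monoInd_congr (recolor_eq_self hb x)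
      · rw [(h i f hf hfe hb).1, (h i f hf hfe hb).2]
  rw [sum_ite_eq'] at h1
  rw [Pi.add_apply]
  by_cases hij : i = j
  · subst hij
    rw [if_pos he] at h1
    rw [Pi.single_eq_same]
    exact_mod_cast h1
  · rw [if_neg fun hei => hij (hr_inj ((hE i e hei).symm.trans (hE j e he)))] at h1
    rw [Pi.single_eq_of_ne hij]
    exact_mod_cast h1

-- After the prefactor, `f` has weight `q ^ (r j + r l - 2)` before recoloring and `q ^ (#(e ∪ f) -
-- 1)` after. The second dominates when the overlap is at least two; for a single common vertex,
-- necessarily different from `v₀`, both are equal.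
omit [Fintype ι] [DecidableEq ι] in
lemma expect_recolor_error_le (hr : ∀ i, 2 ≤ r i) (hE : ∀ i, ∀ e ∈ E i, #e = r i)
    {j l : ι} {e f : Finset V} (he : e ∈ E j) (hf : f ∈ E l) {v₀ : V} (hv₀ : v₀ ∈ e) :
    ((c : ℝ)⁻¹) ^ (r j - 1) * (𝔼 x : V → Fin c,
        if f ≠ e ∧ ¬ ∀ v ∈ e, v ∈ f → v = v₀ then monoInd x f + monoInd (recolor e v₀ x) f else 0) ≤
      2 * (if e ≠ f ∧ 2 ≤ #(e ∩ f) then ((c : ℝ)⁻¹) ^ (#(e ∪ f) - 1) else 0) +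
      2 * ((c : ℝ)⁻¹) ^ (r j - 1) * ∑ w ∈ e.erase v₀,
        ((c : ℝ)⁻¹) ^ (r l - 1) * if {w} ⊆ f then 1 else 0 := by
  obtain ⟨hq, hq1⟩ := inv_natCast_pos_and_le_one c
  set q := (c : ℝ)⁻¹ with hqdef
  have hnn : 0 ≤ 2 * q ^ (r j - 1) * ∑ w ∈ e.erase v₀, q ^ (r l - 1) * if {w} ⊆ f then 1 else 0 :=
    mul_nonneg (by positivity) (sum_nonneg fun w _ => by positivity)
  split_ifs with hbad hov hov
  on_goal 3 => simp only [expect_const_zero, mul_zero]; positivity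
  on_goal 3 => simp only [expect_const_zero, mul_zero]; positivity
  all_goals
    have hbad' := hbad.2
    push Not at hbad'
    obtain ⟨w, hwe, hwf, hw⟩ := hbad'
    have hnf := nonempty_of_card_eq (hr l) (hE l f hf)
    have hef : (e ∩ f).Nonempty := ⟨w, mem_inter.2 ⟨hwe, hwf⟩⟩
    have hu := card_union_add_card_inter e f
    rw [hE j e he, hE l f hf] at hu
    have hpos := card_pos.2 hef
    have h1 := expect_monoInd_mul hv₀ (fun x : V → Fin c => monoInd x f)
    rw [expect_monoInd_mul_monoInd hef, hE j e he] at h1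
    rw [expect_add_distrib, mul_add, ← h1, expect_monoInd hnf, hE l f hf, ← hqdef, ← pow_add]
  · have : q ^ (r j - 1 + (r l - 1)) ≤ q ^ (#(e ∪ f) - 1) :=
      pow_le_pow_of_le_one hq.le hq1 (by have := hr j; have := hr l; omega)
    linarith
  · have h2 : #(e ∩ f) ≤ 1 := by
      by_contra h
      exact hov ⟨hbad.1.symm, by omega⟩
    have h3 : #(e ∪ f) - 1 = r j - 1 + (r l - 1) := by
      have := hr j; have := hr l; omega
    have h4 : q ^ (r l - 1) ≤ ∑ w ∈ e.erase v₀, q ^ (r l - 1) * if {w} ⊆ f then 1 else 0 := by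
      refine le_trans (le_of_eq ?_) (single_le_sum (f := fun w => q ^ (r l - 1) *
        if {w} ⊆ f then (1 : ℝ) else 0) (fun w _ => by positivity) (mem_erase.2 ⟨hw, hwe⟩))
      simp [hwf]
    rw [h3, pow_add]
    have h5 := mul_le_mul_of_nonneg_left h4 (pow_nonneg hq.le (r j - 1))
    linarith

/-- An approximate form of the recursion that characterizes independent Poisson variables. -/
lemma abs_countProb_recursion_le (hr : ∀ i, 2 ≤ r i) (hr_inj : Function.Injective r)
    (hE : ∀ i, ∀ e ∈ E i, #e = r i) (v₀ : Finset V → V) (hv₀ : ∀ i, ∀ e ∈ E i, v₀ e ∈ e)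
    (k : ι → ℕ) (j : ι) :
    |(k j + 1) * countProb c E (k + Pi.single j 1) -
        (#(E j) * ((c : ℝ)⁻¹) ^ (r j - 1)) * countProb c E k| ≤
      (#(E j) * ((c : ℝ)⁻¹) ^ (r j - 1)) * ((c : ℝ)⁻¹) ^ (r j - 1) +
      2 * ∑ l, overlapSum (c : ℝ)⁻¹ (E j) (E l) +
      2 * (((c : ℝ)⁻¹) ^ (r j - 1) * ∑ e ∈ E j, ∑ w ∈ e.erase (v₀ e),
        ∑ l, ((c : ℝ)⁻¹) ^ (r l - 1) * codegree (E l) {w}) := by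
  obtain ⟨hq, hq1⟩ := inv_natCast_pos_and_le_one c
  -- On the event, `k j + 1` equals the sum of the indicators `monoInd x e` over `E j`; each of them
  -- is then traded for a recoloring.
  have hexp : (k j + 1) * countProb c E (k + Pi.single j 1) = ∑ e ∈ E j, ((c : ℝ)⁻¹) ^ (r j - 1) *
      𝔼 x : V → Fin c, if (fun i => monoCount (E i) (recolor e (v₀ e) x)) = k + Pi.single j 1
        then (1 : ℝ) else 0 := by
    have : ∀ x : V → Fin c, ((k j : ℝ) + 1) *
        (if (fun i => monoCount (E i) x) = k + Pi.single j 1 then 1 else 0) =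
        ∑ e ∈ E j, monoInd x e *
          if (fun i => monoCount (E i) x) = k + Pi.single j 1 then 1 else 0 := by
      intro x
      rw [← sum_mul, ← cast_monoCount]
      split_ifs with h
      · have := congrFun h j
        simp only [Pi.add_apply, Pi.single_eq_same] at this
        rw [this]
        push_cast
        rfl
      · simp
    rw [countProb, mul_expect]
    simp_rw [this]
    rw [expect_sum_comm]
    refine sum_congr rfl fun e he => ?_
    refine (expect_monoInd_mul (hv₀ j e he) (fun x : V → Fin c =>
      if (fun i => monoCount (E i) x) = k + Pi.single j 1 then 1 else 0)).trans ?_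
    rw [hE j e he]
  set q := (c : ℝ)⁻¹ with hqdef
  let B : Finset V → (V → Fin c) → ℝ := fun e x => monoInd x e + ∑ l, ∑ f ∈ E l,
    if f ≠ e ∧ ¬ ∀ v ∈ e, v ∈ f → v = v₀ e then
      monoInd x f + monoInd (recolor e (v₀ e) x) f else 0
  have hB : ∀ e ∈ E j, ∀ x : V → Fin c,
      |(if (fun i => monoCount (E i) (recolor e (v₀ e) x)) = k + Pi.single j 1
        then (1 : ℝ) else 0) - if (fun i => monoCount (E i) x) = k then 1 else 0| ≤ B e x := by
    intro e he x
    have hterm : ∀ l, ∀ f ∈ E l, 0 ≤ if f ≠ e ∧ ¬ ∀ v ∈ e, v ∈ f → v = v₀ e then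
        monoInd x f + monoInd (recolor e (v₀ e) x) f else 0 := by
      intro l f _
      split_ifs
      · exact add_nonneg (monoInd_nonneg _ _) (monoInd_nonneg _ _)
      · exact le_rfl
    have hsum : ∀ l ∈ (univ : Finset ι), 0 ≤ ∑ f ∈ E l,
        if f ≠ e ∧ ¬ ∀ v ∈ e, v ∈ f → v = v₀ e then
          monoInd x f + monoInd (recolor e (v₀ e) x) f else 0 :=
      fun l _ => sum_nonneg (hterm l)
    -- `B e x` is a sum of nonnegative integers: either it is at least 1 and the bound is trivial,
    -- or every obstruction vanishes and the two indicators agree.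
    rcases le_or_gt 1 (B e x) with h1 | h1
    · refine le_trans ?_ h1
      split_ifs <;> norm_num
    · have hx0 : monoInd x e = 0 := by
        rcases monoInd_eq_zero_or_one x e with h | h
        · exact h
        · have := sum_nonneg hsum
          simp only [B] at h1
          linarith
      have hT := monoCount_recolor hr_inj hE he (v₀ := v₀ e) hx0 fun l f hf hfe hb => by
        have h2 := single_le_sum hsum (mem_univ l)
        have h3 := single_le_sum (hterm l) hf
        rw [if_pos ⟨hfe, hb⟩] at h3
        simp only [B] at h1
        have h4 := monoInd_nonneg x f
        have h5 := monoInd_nonneg (recolor e (v₀ e) x) f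
        constructor
        · rcases monoInd_eq_zero_or_one x f with h | h
          · exact h
          · linarith
        · rcases monoInd_eq_zero_or_one (recolor e (v₀ e) x) f with h | h
          · exact h
          · linarith
      rw [hT]
      simp only [add_left_inj, sub_self, abs_zero]
      exact add_nonneg (monoInd_nonneg _ _) (sum_nonneg hsum)
  have hEB : ∀ e ∈ E j, q ^ (r j - 1) * 𝔼 x, B e x ≤ q ^ (r j - 1) * q ^ (r j - 1) +
      ∑ l, ∑ f ∈ E l, (2 * (if e ≠ f ∧ 2 ≤ #(e ∩ f) then q ^ (#(e ∪ f) - 1) else 0) +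
      2 * q ^ (r j - 1) * ∑ w ∈ e.erase (v₀ e),
        q ^ (r l - 1) * if {w} ⊆ f then 1 else 0) := by
    intro e he
    simp only [B]
    rw [expect_add_distrib, expect_monoInd (nonempty_of_card_eq (hr j) (hE j e he)), hE j e he,
      expect_sum_comm, mul_add, mul_sum]
    refine add_le_add le_rfl (sum_le_sum fun l _ => ?_)
    rw [expect_sum_comm, mul_sum]
    exact sum_le_sum fun f hf => expect_recolor_error_le hr hE he hf (hv₀ j e he)
  have hdiff : (k j + 1) * countProb c E (k + Pi.single j 1) -
      (#(E j) * q ^ (r j - 1)) * countProb c E k = ∑ e ∈ E j, q ^ (r j - 1) *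
        𝔼 x : V → Fin c, ((if (fun i => monoCount (E i) (recolor e (v₀ e) x)) = k + Pi.single j 1
        then (1 : ℝ) else 0) - if (fun i => monoCount (E i) x) = k then 1 else 0) := by
    simp_rw [expect_sub_distrib, mul_sub]
    rw [hexp, sum_sub_distrib, sum_const, nsmul_eq_mul, countProb]
    ring
  rw [hdiff]
  refine (abs_sum_le_sum_abs _ _).trans ?_
  have hle : ∀ e ∈ E j, |q ^ (r j - 1) * 𝔼 x : V → Fin c,
      ((if (fun i => monoCount (E i) (recolor e (v₀ e) x)) = k + Pi.single j 1
        then (1 : ℝ) else 0) - if (fun i => monoCount (E i) x) = k then 1 else 0)| ≤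
      q ^ (r j - 1) * q ^ (r j - 1) +
      ∑ l, ∑ f ∈ E l, (2 * (if e ≠ f ∧ 2 ≤ #(e ∩ f) then q ^ (#(e ∪ f) - 1) else 0) +
      2 * q ^ (r j - 1) * ∑ w ∈ e.erase (v₀ e),
        q ^ (r l - 1) * if {w} ⊆ f then 1 else 0) := by
    intro e he
    refine le_trans ?_ (hEB e he)
    rw [abs_mul, abs_of_nonneg (by positivity : 0 ≤ q ^ (r j - 1))]
    gcongr
    exact (abs_expect_le _ _).trans (expect_le_expect fun x _ => hB e he x)
  refine (sum_le_sum hle).trans (le_of_eq ?_)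
  have hov : ∑ e ∈ E j, ∑ l, ∑ f ∈ E l,
      2 * (if e ≠ f ∧ 2 ≤ #(e ∩ f) then q ^ (#(e ∪ f) - 1) else 0) =
      2 * ∑ l, overlapSum q (E j) (E l) := by
    rw [sum_comm, mul_sum]
    refine sum_congr rfl fun l _ => ?_
    simp_rw [overlapSum, mul_sum]
  have hdeg : ∑ e ∈ E j, ∑ l, ∑ f ∈ E l, 2 * q ^ (r j - 1) * ∑ w ∈ e.erase (v₀ e),
      q ^ (r l - 1) * (if {w} ⊆ f then (1 : ℝ) else 0) =
      2 * (q ^ (r j - 1) * ∑ e ∈ E j, ∑ w ∈ e.erase (v₀ e), ∑ l, q ^ (r l - 1) *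
        codegree (E l) {w}) := by
    simp_rw [← mul_assoc, codegree, mul_sum]
    refine sum_congr rfl fun e _ => ?_
    rw [sum_comm]
    refine sum_congr rfl fun l _ => ?_
    rw [sum_comm]
  simp only [sum_add_distrib]
  rw [hov, hdeg, sum_const, nsmul_eq_mul]
  ring

end

end Recursion

/-! ### Error bounds with the best choice of `v₀`, and tightness. -/

section FixedColoring

open scoped BigOperators
open Finset

variable {V ι : Type*} [DecidableEq V] [Fintype V] [Fintype ι] [DecidableEq ι] {c : ℕ} [NeZero c]
  {E : ι → Finset (Finset V)} {r : ι → ℕ}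

omit [Fintype ι] [DecidableEq ι] in
lemma sum_codegree_singleton (hE : ∀ i, ∀ e ∈ E i, #e = r i) (l : ι) :
    ∑ v, codegree (E l) {v} = r l * #(E l) := by
  simp_rw [codegree, singleton_subset_iff]
  rw [sum_comm, sum_congr rfl (g := fun _ => (r l : ℝ))]
  · simp [mul_comm]
  · intro e he
    simp [← hE l e he]

lemma abs_countProb_recursion_le_sqrt (hr : ∀ i, 2 ≤ r i) (hr_inj : Function.Injective r)
    (hE : ∀ i, ∀ e ∈ E i, #e = r i) (k : ι → ℕ) (j : ι) :
    |(k j + 1) * countProb c E (k + Pi.single j 1) -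
        (#(E j) * ((c : ℝ)⁻¹) ^ (r j - 1)) * countProb c E k| ≤
      (#(E j) * ((c : ℝ)⁻¹) ^ (r j - 1)) * ((c : ℝ)⁻¹) ^ (r j - 1) +
      2 * ∑ l, overlapSum (c : ℝ)⁻¹ (E j) (E l) +
      2 * √(r j ^ 2 * (c : ℝ)⁻¹ *
        (#(E j) * ((c : ℝ)⁻¹) ^ (r j - 1) + overlapSum (c : ℝ)⁻¹ (E j) (E j)) *
        (∑ l, r l * (#(E l) * ((c : ℝ)⁻¹) ^ (r l - 1))) ^ 2) := by
  obtain ⟨hq, hq1⟩ := inv_natCast_pos_and_le_one c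
  have hne : ∀ i, ∀ e ∈ E i, e.Nonempty := fun i e he => nonempty_of_card_eq (hr i) (hE i e he)
  rcases isEmpty_or_nonempty V with hV | hV
  · have h0 : ∀ i, E i = ∅ := fun i => eq_empty_of_forall_notMem fun e he => by
      obtain ⟨v, -⟩ := hne i e he
      exact hV.elim v
    have h1 : countProb c E (k + Pi.single j 1) = 0 := by
      unfold countProb
      refine expect_eq_zero fun x _ => if_neg fun h => ?_
      have := congrFun h j
      simp [monoCount, h0] at this
    rw [h1, h0 j]
    simp only [card_empty, Nat.cast_zero, zero_mul, mul_zero, sub_zero, abs_zero, zero_add]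
    have : ∀ l, 0 ≤ overlapSum (c : ℝ)⁻¹ ∅ (E l) := fun l => overlapSum_nonneg hq.le _ _
    exact add_nonneg (mul_nonneg zero_le_two (sum_nonneg fun l _ => this l)) (by positivity)
  -- The weighted degree over all layers; `v₀ e` is taken to maximize it on `e`.
  · let D : V → ℝ := fun v => ∑ l, ((c : ℝ)⁻¹) ^ (r l - 1) * codegree (E l) {v}
    have hD : ∀ v, 0 ≤ D v := fun v => sum_nonneg fun l _ =>
      mul_nonneg (by positivity) (sum_nonneg fun e _ => by positivity)
    have hex : ∀ e : Finset V, ∃ v, e.Nonempty → v ∈ e ∧ ∀ w ∈ e, D w ≤ D v := by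
      intro e
      by_cases he : e.Nonempty
      · obtain ⟨v, hv, hmax⟩ := exists_max_image e D he
        exact ⟨v, fun _ => ⟨hv, hmax⟩⟩
      · exact ⟨Classical.arbitrary V, fun h => absurd h he⟩
    choose v₀ hv₀ using hex
    refine (abs_countProb_recursion_le hr hr_inj hE v₀
      (fun i e he => (hv₀ e (hne i e he)).1) k j).trans ?_
    gcongr
    apply Real.le_sqrt_of_sq_le
    have hsumD : ∑ v, D v = ∑ l, r l * (#(E l) * ((c : ℝ)⁻¹) ^ (r l - 1)) := by
      rw [sum_comm]
      refine sum_congr rfl fun l _ => ?_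
      rw [← mul_sum, sum_codegree_singleton hE]
      ring
    rw [← hsumD]
    exact sum_sum_erase_sq_le hq hq1 (hr j) (hE j) D hD v₀ (fun e he => (hv₀ e (hne j e he)).1)
      fun e he => (hv₀ e (hne j e he)).2

-- Common subsets have at most `r i < r l` vertices, so the diagonal of the larger layer gains a
-- factor `q`. With vanishing overlaps inside the layers, this factor tends to zero while the other
-- stays bounded.
omit [Fintype ι] [DecidableEq ι] in
lemma overlapSum_sq_le_of_lt {i l : ι} (hE : ∀ i, ∀ e ∈ E i, #e = r i) (hil : r i < r l) :
    overlapSum (c : ℝ)⁻¹ (E i) (E l) ^ 2 ≤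
      (2 ^ r i * (#(E i) * ((c : ℝ)⁻¹) ^ (r i - 1) + overlapSum (c : ℝ)⁻¹ (E i) (E i))) *
      (2 ^ r l * (#(E l) * ((c : ℝ)⁻¹) ^ (r l - 1) * (c : ℝ)⁻¹ +
        overlapSum (c : ℝ)⁻¹ (E l) (E l))) := by
  obtain ⟨hq, hq1⟩ := inv_natCast_pos_and_le_one c
  refine (overlapSum_sq_le hq (hE i) (hE l) hil.le).trans ?_
  have h1 := sum_codegree_sq_le hq hq1 (hE i) le_rfl
  rw [Nat.sub_self, pow_zero, mul_one] at h1
  have h2 := sum_codegree_sq_le hq hq1 (hE l) hil.le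
  have h3 : ((c : ℝ)⁻¹) ^ (r l - r i) ≤ (c : ℝ)⁻¹ := pow_le_of_le_one hq.le hq1 (by omega)
  refine mul_le_mul h1 (h2.trans ?_) (sum_nonneg fun S _ => by positivity)
    (mul_nonneg (by positivity) (add_nonneg (by positivity) (overlapSum_nonneg hq.le _ _)))
  gcongr

/-- Markov's inequality: outside the cube some count is at least `K`. -/
lemma one_sub_le_sum_countProb {K : ℕ} (hK : 0 < K) :
    1 - (∑ i, 𝔼 x : V → Fin c, (monoCount (E i) x : ℝ)) / K ≤
      ∑ k ∈ Fintype.piFinset fun _ : ι => range K, countProb c E k := by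
  unfold countProb
  rw [← expect_sum_comm, ← expect_sum_comm, expect_div]
  conv_lhs => rw [← Fintype.expect_one (ι := V → Fin c), ← expect_sub_distrib]
  refine expect_le_expect fun x _ => ?_
  rw [sum_ite_eq]
  have hK' : (0 : ℝ) < K := Nat.cast_pos.2 hK
  split_ifs with h
  · exact sub_le_self 1 (div_nonneg (sum_nonneg fun _ _ => Nat.cast_nonneg _) hK'.le)
  · rw [Fintype.mem_piFinset] at h
    push Not at h
    obtain ⟨i, hi⟩ := h
    rw [mem_range, not_lt] at hi
    rw [sub_nonpos, one_le_div hK']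
    calc (K : ℝ) ≤ monoCount (E i) x := by exact_mod_cast hi
      _ ≤ ∑ i, (monoCount (E i) x : ℝ) :=
        single_le_sum (f := fun i => (monoCount (E i) x : ℝ)) (fun _ _ => by positivity)
          (mem_univ i)

omit [Fintype ι] [DecidableEq ι] [NeZero c] in
lemma countProb_nonneg [Fintype ι] (k : ι → ℕ) : 0 ≤ countProb c E k :=
  expect_nonneg fun x _ => by positivity

end FixedColoring

/-! ### From the approximate recursion to Poisson lower bounds. -/

section Limits

open Finset

/-- A sequence of functions on `ι → ℕ` which asymptotically satisfies the recursion of independent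
Poisson variables, and is tight, is asymptotically at least the Poisson mass function. -/
lemma eventually_poisson_le_of_recursion {ι : Type*} [Fintype ι] [DecidableEq ι]
    {Q : ℕ → (ι → ℕ) → ℝ} {a : ι → ℕ → ℝ} {lam : ι → ℝ} (hlam : ∀ i, 0 ≤ lam i)
    (ha : ∀ i, Tendsto (a i) atTop (𝓝 (lam i))) (hQ : ∀ n k, 0 ≤ Q n k)
    (hrec : ∀ k j, Tendsto (fun n => (k j + 1) * Q n (k + Pi.single j 1) - a j n * Q n k)
      atTop (𝓝 0))
    (htight : ∀ ε > 0, ∃ K : ℕ, ∀ᶠ n in atTop,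
      1 - ε ≤ ∑ k ∈ Fintype.piFinset fun _ : ι => range K, Q n k)
    (hbdd : ∀ᶠ n in atTop, Q n 0 ≤ 1)
    (k : ι → ℕ) {ε : ℝ} (hε : 0 < ε) :
    ∀ᶠ n in atTop, ∏ i, Real.exp (-lam i) * lam i ^ k i / (k i).factorial - ε ≤ Q n k := by
  -- The Poisson mass function without its factor `exp (-∑ i, lam i)`; it solves the limiting
  -- recursion with value 1 at 0.
  let w : (ι → ℕ) → ℝ := fun k => ∏ i, lam i ^ k i / (k i).factorial
  have hw : ∀ k, 0 ≤ w k := fun k => prod_nonneg fun i _ => by have := hlam i; positivity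
  have hwstep : ∀ (k : ι → ℕ) j, (k j + 1) * w (k + Pi.single j 1) = lam j * w k := by
    intro k j
    simp only [w]
    rw [← mul_prod_erase univ _ (mem_univ j), ← mul_prod_erase univ (fun i => lam i ^ k i / _)
      (mem_univ j)]
    have h1 : ∏ i ∈ univ.erase j, lam i ^ (k + Pi.single j 1 : ι → ℕ) i /
        (((k + Pi.single j 1 : ι → ℕ) i).factorial : ℝ) =
        ∏ i ∈ univ.erase j, lam i ^ k i / ((k i).factorial : ℝ) := by
      refine prod_congr rfl fun i hi => ?_
      rw [Pi.add_apply, Pi.single_eq_of_ne (ne_of_mem_erase hi), add_zero]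
    rw [h1, Pi.add_apply, Pi.single_eq_same, Nat.factorial_succ, pow_succ]
    push_cast
    field_simp
  have hQ0 : ∀ N : ℕ, ∀ k : ι → ℕ, ∑ i, k i = N →
      Tendsto (fun n => Q n k - w k * Q n 0) atTop (𝓝 0) := by
    intro N
    induction N with
    | zero =>
      intro k hk
      have : k = 0 := funext fun i => (sum_eq_zero_iff.1 hk) i (mem_univ i)
      simp [this, w]
    | succ N ih =>
      intro k hk
      obtain ⟨j, -, hj⟩ : ∃ j ∈ univ, k j ≠ 0 := by
        by_contra! h
        rw [sum_eq_zero h] at hk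
        omega
      obtain ⟨k', rfl⟩ : ∃ k' : ι → ℕ, k = k' + Pi.single j 1 := by
        refine ⟨k - Pi.single j 1, funext fun i => ?_⟩
        by_cases hij : i = j
        · subst hij
          simp only [Pi.add_apply, Pi.sub_apply, Pi.single_eq_same]
          omega
        · simp [Pi.single_eq_of_ne hij]
      have hk' : ∑ i, k' i = N := by
        simp only [Pi.add_apply, sum_add_distrib, sum_pi_single', mem_univ, if_true] at hk
        omega
      have h1 := hrec k' j
      have h2 := (ih k' hk').mul_const (lam j)
      -- Replacing `a j n` by its limit needs `Q n k'` bounded: by induction it is close to `w k' *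
      -- Q n 0`, hence eventually at most `w k' + 1`.
      have h3 : Tendsto (fun n => (a j n - lam j) * Q n k') atTop (𝓝 0) := by
        have h4 : Tendsto (fun n => (a j n - lam j) * (w k' + 1)) atTop (𝓝 0) := by
          simpa using ((ha j).sub_const (lam j)).mul_const (w k' + 1)
        refine squeeze_zero_norm' ?_ (by simpa only [norm_zero] using h4.norm)
        filter_upwards [(ih k' hk').eventually (Iio_mem_nhds one_pos), hbdd] with n hn hn1
        have : w k' * Q n 0 ≤ w k' * 1 := mul_le_mul_of_nonneg_left hn1 (hw k')
        rw [norm_mul, Real.norm_of_nonneg (hQ n k')]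
        calc ‖a j n - lam j‖ * Q n k' ≤ ‖a j n - lam j‖ * (w k' + 1) := by gcongr; linarith
          _ = ‖(a j n - lam j) * (w k' + 1)‖ := by
            rw [norm_mul, Real.norm_of_nonneg (by have := hw k'; linarith : 0 ≤ w k' + 1)]
      have h5 := ((h1.add h2).add h3).div_const ((k' j : ℝ) + 1)
      have hpos : (k' j : ℝ) + 1 ≠ 0 := by positivity
      simp only [zero_mul, add_zero, zero_div] at h5
      refine h5.congr fun n => ?_
      rw [div_eq_iff hpos]
      linear_combination (Q n 0) * (hwstep k' j)
  have hQw : ∀ k, Tendsto (fun n => Q n k - w k * Q n 0) atTop (𝓝 0) := fun k => hQ0 _ k rfl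
  have hexp : ∀ K : ℕ, ∑ k ∈ Fintype.piFinset fun _ : ι => range K, w k ≤
      Real.exp (∑ i, lam i) := by
    intro K
    rw [← prod_univ_sum (t := fun _ => range K)
      (f := fun i m => lam i ^ m / (m.factorial : ℝ)), Real.exp_sum]
    exact prod_le_prod (fun i _ => sum_nonneg fun m _ => by have := hlam i; positivity)
      fun i _ => Real.sum_le_exp_of_nonneg (hlam i) K
  set L := ∑ i, lam i with hL
  -- By tightness almost all the mass lies in a cube, where it is about `Q n 0 * ∑ w ≤ Q n 0 * exp
  -- L`. The two errors of `δ * exp L / 2` add up to `δ` after division by `exp L`.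
  have hzero : ∀ δ > 0, ∀ᶠ n in atTop, Real.exp (-L) - δ ≤ Q n 0 := by
    intro δ hδ
    have hδ' : 0 < δ * Real.exp L / 2 := by positivity
    obtain ⟨K, hK⟩ := htight _ hδ'
    have hsum : Tendsto (fun n => ∑ k ∈ Fintype.piFinset fun _ : ι => range K,
        (Q n k - w k * Q n 0)) atTop (𝓝 0) := by
      simpa using tendsto_finsetSum (Fintype.piFinset fun _ : ι => range K) fun k _ => hQw k
    filter_upwards [hK, hsum.eventually (Iio_mem_nhds hδ')] with n hn1 hn2
    rw [sum_sub_distrib, ← sum_mul] at hn2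
    have h1 := mul_le_mul_of_nonneg_right (hexp K) (hQ n 0)
    have h2 : Real.exp L * (Real.exp (-L) - δ) ≤ Real.exp L * Q n 0 := by
      rw [mul_sub, ← Real.exp_add, add_neg_cancel, Real.exp_zero]
      linarith
    exact le_of_mul_le_mul_left h2 (Real.exp_pos L)
  have hprod : ∏ i, Real.exp (-lam i) * lam i ^ k i / (k i).factorial = w k * Real.exp (-L) := by
    simp_rw [mul_div_assoc]
    rw [prod_mul_distrib, ← Real.exp_sum, sum_neg_distrib, mul_comm]
  rw [hprod]
  have hwk := hw k
  filter_upwards [hzero (ε / (2 * (w k + 1))) (by positivity),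
    (hQw k).eventually (Ioi_mem_nhds (by linarith : -(ε / 2) < 0))] with n hn1 hn2
  have h1 := mul_le_mul_of_nonneg_left hn1 hwk
  have h2 : w k * (ε / (2 * (w k + 1))) ≤ ε / 2 := by
    rw [mul_div_assoc', div_le_div_iff₀ (by positivity) two_pos]
    nlinarith
  linarith

end Limits

/-! ### Asymptotics along the sequence of colorings. -/

section ColoringSequences

open scoped BigOperators
open Finset

variable {ι : Type*} {V : ℕ → Type*} [∀ n, Fintype (V n)] [∀ n, DecidableEq (V n)] {c : ℕ → ℕ}
  {E : ∀ n, ι → Finset (Finset (V n))} {r : ι → ℕ} {lam : ι → ℝ}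

lemma tendsto_card_mul_pow (hc : Tendsto c atTop atTop) (hr : ∀ i, 2 ≤ r i)
    (hE : ∀ n i, ∀ e ∈ E n i, #e = r i)
    (hmean : ∀ i, Tendsto (fun n => 𝔼 x : V n → Fin (c n), (monoCount (E n i) x : ℝ)) atTop
      (𝓝 (lam i))) (i : ι) :
    Tendsto (fun n => #(E n i) * ((c n : ℝ)⁻¹) ^ (r i - 1)) atTop (𝓝 (lam i)) := by
  refine (hmean i).congr' ?_
  filter_upwards [hc.eventually_gt_atTop 0] with n hn
  have : NeZero (c n) := ⟨hn.ne'⟩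
  exact expect_monoCount (hr i) (hE n i)

lemma tendsto_inv_natCast (hc : Tendsto c atTop atTop) :
    Tendsto (fun n => (c n : ℝ)⁻¹) atTop (𝓝 0) :=
  tendsto_inv_atTop_zero.comp (tendsto_natCast_atTop_atTop.comp hc)

lemma tendsto_inv_natCast_pow (hc : Tendsto c atTop atTop) {m : ℕ} (hm : m ≠ 0) :
    Tendsto (fun n => ((c n : ℝ)⁻¹) ^ m) atTop (𝓝 0) := by
  simpa [hm] using (tendsto_inv_natCast hc).pow m

lemma tendsto_overlapSum_self (hc : Tendsto c atTop atTop) (hr : ∀ i, 2 ≤ r i)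
    (hE : ∀ n i, ∀ e ∈ E n i, #e = r i)
    (hmean : ∀ i, Tendsto (fun n => 𝔼 x : V n → Fin (c n), (monoCount (E n i) x : ℝ)) atTop
      (𝓝 (lam i)))
    (hvar : ∀ i, Tendsto (fun n => 𝔼 x : V n → Fin (c n), (monoCount (E n i) x : ℝ) ^ 2 -
      (𝔼 x : V n → Fin (c n), (monoCount (E n i) x : ℝ)) ^ 2) atTop (𝓝 (lam i))) (i : ι) :
    Tendsto (fun n => overlapSum (c n : ℝ)⁻¹ (E n i) (E n i)) atTop (𝓝 0) := by
  -- Variance minus mean tends to `lam i - lam i = 0`; the factor 2 absorbs `1 - q ≥ 1 / 2`.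
  have hlim := ((hvar i).sub (((tendsto_inv_natCast_pow hc
    (show r i - 1 ≠ 0 by have := hr i; omega)).const_sub 1).mul (hmean i))).const_mul 2
  simp only [sub_zero, one_mul, sub_self, mul_zero] at hlim
  refine squeeze_zero' (Eventually.of_forall fun n => overlapSum_nonneg (by positivity) _ _) ?_ hlim
  filter_upwards [hc.eventually_ge_atTop 2] with n hn
  have : NeZero (c n) := ⟨by omega⟩
  have h1 := overlapSum_le_variance (c := c n) (hr i) (hE n i)
  have h2 : (c n : ℝ)⁻¹ ≤ 2⁻¹ := inv_anti₀ two_pos (by exact_mod_cast hn)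
  have h3 := overlapSum_nonneg (inv_natCast_pos_and_le_one (c n)).1.le (E n i) (E n i)
  have h4 := mul_le_mul_of_nonneg_right h2 h3
  linarith

lemma tendsto_overlapSum (hc : Tendsto c atTop atTop) (hr : ∀ i, 2 ≤ r i)
    (hr_inj : Function.Injective r) (hE : ∀ n i, ∀ e ∈ E n i, #e = r i)
    (hmean : ∀ i, Tendsto (fun n => 𝔼 x : V n → Fin (c n), (monoCount (E n i) x : ℝ)) atTop
      (𝓝 (lam i)))
    (hvar : ∀ i, Tendsto (fun n => 𝔼 x : V n → Fin (c n), (monoCount (E n i) x : ℝ) ^ 2 -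
      (𝔼 x : V n → Fin (c n), (monoCount (E n i) x : ℝ)) ^ 2) atTop (𝓝 (lam i))) (i l : ι) :
    Tendsto (fun n => overlapSum (c n : ℝ)⁻¹ (E n i) (E n l)) atTop (𝓝 0) := by
  have ha := tendsto_card_mul_pow hc hr hE hmean
  have hself := tendsto_overlapSum_self hc hr hE hmean hvar
  have hlt : ∀ i l, r i < r l →
      Tendsto (fun n => overlapSum (c n : ℝ)⁻¹ (E n i) (E n l)) atTop (𝓝 0) := by
    intro i l hil
    have hlim := (((ha i).add (hself i)).const_mul (2 ^ r i)).mul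
      ((((ha l).mul (tendsto_inv_natCast hc)).add (hself l)).const_mul (2 ^ r l))
    simp only [mul_zero, add_zero] at hlim
    have hsq : Tendsto (fun n => overlapSum (c n : ℝ)⁻¹ (E n i) (E n l) ^ 2) atTop (𝓝 0) := by
      refine squeeze_zero' (Eventually.of_forall fun n => sq_nonneg _) ?_ hlim
      filter_upwards [hc.eventually_gt_atTop 0] with n hn
      have : NeZero (c n) := ⟨hn.ne'⟩
      exact overlapSum_sq_le_of_lt (hE n) hil
    have := hsq.sqrt
    rw [Real.sqrt_zero] at this
    exact this.congr fun n => Real.sqrt_sq (overlapSum_nonneg (by positivity) _ _)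
  rcases lt_trichotomy (r i) (r l) with h | h | h
  · exact hlt i l h
  · rw [hr_inj h]
    exact hself l
  · exact (hlt l i h).congr fun n => overlapSum_comm _ _ _

variable [Fintype ι] [DecidableEq ι]

lemma eventually_poisson_le_countProb (hc : Tendsto c atTop atTop) (hr : ∀ i, 2 ≤ r i)
    (hr_inj : Function.Injective r) (hE : ∀ n i, ∀ e ∈ E n i, #e = r i) (hlam : ∀ i, 0 ≤ lam i)
    (hmean : ∀ i, Tendsto (fun n => 𝔼 x : V n → Fin (c n), (monoCount (E n i) x : ℝ)) atTop
      (𝓝 (lam i)))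
    (hvar : ∀ i, Tendsto (fun n => 𝔼 x : V n → Fin (c n), (monoCount (E n i) x : ℝ) ^ 2 -
      (𝔼 x : V n → Fin (c n), (monoCount (E n i) x : ℝ)) ^ 2) atTop (𝓝 (lam i)))
    (k : ι → ℕ) {ε : ℝ} (hε : 0 < ε) :
    ∀ᶠ n in atTop, ∏ i, Real.exp (-lam i) * lam i ^ k i / (k i).factorial - ε ≤
      countProb (c n) (E n) k := by
  have ha := tendsto_card_mul_pow hc hr hE hmean
  have hov := tendsto_overlapSum hc hr hr_inj hE hmean hvar
  refine eventually_poisson_le_of_recursion (Q := fun n => countProb (c n) (E n)) hlam ha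
    (fun n k => countProb_nonneg k) ?_ ?_ ?_ k hε
  · intro k j
    have hsum : Tendsto (fun n => ∑ l, (r l : ℝ) * (#(E n l) * ((c n : ℝ)⁻¹) ^ (r l - 1))) atTop
        (𝓝 (∑ l, r l * lam l)) := tendsto_finsetSum _ fun l _ => (ha l).const_mul _
    have hlim := (((ha j).mul (tendsto_inv_natCast_pow hc
      (show r j - 1 ≠ 0 by have := hr j; omega))).add
      ((tendsto_finsetSum univ fun l _ => hov j l).const_mul 2)).add
      (((((tendsto_inv_natCast hc).const_mul ((r j : ℝ) ^ 2)).mul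
        ((ha j).add (hov j j))).mul (hsum.pow 2)).sqrt.const_mul 2)
    simp only [mul_zero, zero_mul, add_zero, sum_const_zero, Real.sqrt_zero] at hlim
    refine squeeze_zero_norm' ?_ hlim
    filter_upwards [hc.eventually_gt_atTop 0] with n hn
    have : NeZero (c n) := ⟨hn.ne'⟩
    exact abs_countProb_recursion_le_sqrt hr hr_inj (hE n) k j
  · intro δ hδ
    have hsum := tendsto_finsetSum univ fun i _ => hmean i
    obtain ⟨K, hK⟩ := exists_nat_gt ((∑ i, lam i + 1) / δ)
    have hpos : 0 < ∑ i, lam i + 1 := by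
      have := sum_nonneg fun i (_ : i ∈ univ) => hlam i
      linarith
    have hK0 : (0 : ℝ) < K := lt_trans (by positivity) hK
    refine ⟨K, ?_⟩
    filter_upwards [hc.eventually_gt_atTop 0,
      hsum.eventually (Iio_mem_nhds (lt_add_one _))] with n hn hn2
    have : NeZero (c n) := ⟨hn.ne'⟩
    refine le_trans ?_ (one_sub_le_sum_countProb (Nat.cast_pos.1 hK0))
    rw [div_lt_iff₀ hδ] at hK
    have : (∑ i, 𝔼 x : V n → Fin (c n), (monoCount (E n i) x : ℝ)) / K ≤ δ := by
      rw [div_le_iff₀ hK0]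
      linarith
    linarith
  · filter_upwards [hc.eventually_gt_atTop 0] with n hn
    have : NeZero (c n) := ⟨hn.ne'⟩
    rw [← Fintype.expect_one (ι := V n → Fin (c n)) (M := ℝ)]
    exact expect_le_expect fun x _ => by split_ifs <;> norm_num

end ColoringSequences

/-! ### From averages over colorings to convergence in distribution. -/

section Transfer

open scoped BigOperators
open Finset

open Classical in
/-- The edges of a hypergraph on a finite vertex type, as finsets of vertices. -/
noncomputable def Hypergraph.edges {V : Type*} [Fintype V] (H : Hypergraph V) :
    Finset (Finset V) :=
  Finset.univ.filter fun e : Finset V => (e : Set V) ∈ H.edgeSet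

lemma monochromaticCount_eq_monoCount {V C : Type*} [Fintype V] (H : Hypergraph V) (x : V → C) :
    monochromaticCount H x = monoCount H.edges x := by
  classical
  rw [monochromaticCount, monoCount, ← Set.ncard_coe_finset,
    ← Set.ncard_image_of_injective _ (Finset.coe_injective (α := V))]
  congr 1
  ext e
  simp only [Set.mem_ofPred_eq, Set.mem_image, mem_coe, mem_filter, Hypergraph.edges, mem_univ,
    true_and]
  constructor
  · rintro ⟨he, hm⟩
    exact ⟨e.toFinite.toFinset, by simpa using ⟨he, hm⟩, by simp⟩
  · rintro ⟨f, hf, rfl⟩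
    exact hf

lemma card_of_mem_edges {V : Type*} [Fintype V] {H : Hypergraph V} {r : ℕ} (hH : H.IsUniform r)
    {e : Finset V} (he : e ∈ H.edges) : #e = r := by
  have := hH e (by simpa [Hypergraph.edges] using he)
  rw [Set.encard_coe_eq_coe_finsetCard] at this
  exact_mod_cast this

section

variable {V Ω : Type*} [Fintype V] [DecidableEq V] [MeasurableSpace Ω] {c : ℕ} {X : V → Ω → Fin c}
  {P : Measure Ω} [IsProbabilityMeasure P]

omit [Fintype V] [DecidableEq V] [IsProbabilityMeasure P] in
lemma IsUniformRandomColoring.measurable_coloring (hX : IsUniformRandomColoring X P) :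
    Measurable fun ω v => X v ω :=
  measurable_pi_lambda _ hX.measurable

/-- The expectation of a function of a uniformly random coloring is its average over all
colorings. -/
lemma IsUniformRandomColoring.integral_comp (hX : IsUniformRandomColoring X P)
    (g : (V → Fin c) → ℝ) : ∫ ω, g (fun v => X v ω) ∂P = 𝔼 x, g x := by
  have hmeas := hX.measurable_coloring
  have : IsProbabilityMeasure (P.map fun ω v => X v ω) :=
    Measure.isProbabilityMeasure_map hmeas.aemeasurable
  have hsing : ∀ x : V → Fin c,
      (P.map fun ω v => X v ω).real {x} = (1 / (c : ℝ)) ^ Fintype.card V := by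
    intro x
    rw [measureReal_def, Measure.map_apply hmeas (measurableSet_singleton x)]
    have : (fun ω v => X v ω) ⁻¹' {x} = ⋂ v ∈ (univ : Finset V), X v ⁻¹' {x v} := by
      ext ω
      simp [funext_iff]
    rw [this, hX.iIndepFun.measure_inter_preimage_eq_mul univ
      (fun v _ => measurableSet_singleton (x v)), ENNReal.toReal_prod]
    refine (prod_congr rfl (g := fun _ => 1 / (c : ℝ)) fun v _ => hX.uniform v (x v)).trans ?_
    simp
  rw [← integral_map (φ := fun ω v => X v ω) hmeas.aemeasurable
    (measurable_of_finite g).aestronglyMeasurable, integral_fintype Integrable.of_finite,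
    Fintype.expect_eq_sum_div_card, sum_div]
  refine sum_congr rfl fun x _ => ?_
  rw [hsing, smul_eq_mul, Fintype.card_fun, Fintype.card_fin]
  push_cast
  ring

lemma IsUniformRandomColoring.measureReal_eq_countProb {ι : Type*} [Fintype ι] [DecidableEq ι]
    (hX : IsUniformRandomColoring X P) (E : ι → Finset (Finset V)) (k : ι → ℕ) :
    P.real {ω | (fun i => monoCount (E i) fun v => X v ω) = k} = countProb c E k := by
  have hmeas : MeasurableSet {ω | (fun i => monoCount (E i) fun v => X v ω) = k} :=
    hX.measurable_coloring (Set.toFinite {x | (fun i => monoCount (E i) x) = k}).measurableSet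
  rw [countProb, ← hX.integral_comp, ← integral_indicator_one hmeas]
  refine integral_congr_ae (Eventually.of_forall fun ω => ?_)
  simp [Set.indicator_apply]

end

/-- Pointwise asymptotic lower bounds for the mass functions imply convergence in distribution of
random vectors with natural number entries. -/
lemma tendstoInDistribution_of_eventually_le {ι : Type*} [Fintype ι] {Ω : ℕ → Type*}
    [∀ n, MeasurableSpace (Ω n)] {P : ∀ n, Measure (Ω n)} [∀ n, IsProbabilityMeasure (P n)]
    {Ω' : Type*} [MeasurableSpace Ω'] {P' : Measure Ω'} [IsProbabilityMeasure P']
    {T : ∀ n, Ω n → ι → ℕ} (hT : ∀ n, Measurable (T n)) {Z : Ω' → ι → ℕ} (hZ : AEMeasurable Z P')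
    (h : ∀ k, ∀ ε > 0, ∀ᶠ n in atTop, (P'.map Z).real {k} - ε ≤ (P n).real {ω | T n ω = k}) :
    TendstoInDistribution (fun n ω i => (T n ω i : ℝ)) atTop (fun ω i => (Z ω i : ℝ)) P P' := by
  have hcast : Measurable fun (k : ι → ℕ) (i : ι) => (k i : ℝ) := by fun_prop
  refine ⟨fun n => (hcast.comp (hT n)).aemeasurable, hcast.comp_aemeasurable hZ, ?_⟩
  refine tendsto_of_forall_isOpen_le_liminf' fun G hG => ?_
  have : IsProbabilityMeasure (P'.map Z) := Measure.isProbabilityMeasure_map hZ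
  simp only [ProbabilityMeasure.coe_mk]
  set A : Set (ι → ℕ) := (fun k i => (k i : ℝ)) ⁻¹' G with hA
  have hmapZ : P'.map (fun ω i => (Z ω i : ℝ)) G = P'.map Z A := by
    rw [← Measure.map_apply hcast hG.measurableSet,
      AEMeasurable.map_map_of_aemeasurable hcast.aemeasurable hZ]
    rfl
  have hmapT : ∀ n, (P n).map (fun ω i => (T n ω i : ℝ)) G = P n (T n ⁻¹' A) := by
    intro n
    exact Measure.map_apply (hcast.comp (hT n)) hG.measurableSet
  rw [hmapZ]
  simp_rw [hmapT]
  refine le_of_forall_lt_imp_le_of_dense fun b hb => le_liminf_of_le (by isBoundedDefault) ?_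
  classical
  -- The limit law is carried by a countable set, so finitely many atoms of `A` already have mass
  -- above `b`, and only their lower bounds are needed.
  rw [← Measure.tsum_indicator_apply_singleton _ A (Set.to_countable A).measurableSet,
    ENNReal.tsum_eq_iSup_sum, lt_iSup_iff] at hb
  obtain ⟨F, hF⟩ := hb
  simp_rw [Set.indicator_apply] at hF
  rw [← sum_filter] at hF
  set F' := F.filter (· ∈ A)
  have hb_top : b ≠ ⊤ := hF.ne_top
  have hF_real : b.toReal < ∑ k ∈ F', (P'.map Z).real {k} := by
    simp_rw [measureReal_def]
    rw [← ENNReal.toReal_sum fun k _ => measure_ne_top _ _]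
    exact (ENNReal.toReal_lt_toReal hb_top
      (ENNReal.sum_ne_top.2 fun k _ => measure_ne_top _ _)).2 hF
  -- The gap above `b` is shared among the atoms; the `+ 1` covers an empty `F'`.
  set δ := (∑ k ∈ F', (P'.map Z).real {k} - b.toReal) / (#F' + 1) with hδ
  have hδ0 : 0 < δ := div_pos (by linarith) (by positivity)
  filter_upwards [(eventually_all_finset F').2 fun k _ => h k δ hδ0] with n hn
  have h1 : b.toReal ≤ ∑ k ∈ F', (P n).real (T n ⁻¹' {k}) := by
    have h2 := sum_le_sum hn
    rw [sum_sub_distrib, sum_const, nsmul_eq_mul] at h2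
    have h3 : (#F' + 1 : ℝ) * δ = ∑ k ∈ F', (P'.map Z).real {k} - b.toReal := by
      rw [hδ]
      field_simp
    refine le_trans ?_ h2
    linarith
  have h4 : ∑ k ∈ F', (P n).real (T n ⁻¹' {k}) ≤ (P n).real (T n ⁻¹' A) := by
    rw [← measureReal_biUnion_finset
      (fun k _ l _ hkl => Disjoint.preimage _ (Set.disjoint_singleton.2 hkl))
      fun k _ => hT n (measurableSet_singleton k)]
    refine measureReal_mono (Set.iUnion₂_subset fun k hk ω hω => ?_)
    have : T n ω = k := hω
    rw [Set.mem_preimage, this]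
    exact (mem_filter.1 hk).2
  exact (ENNReal.le_ofReal_iff_toReal_le hb_top measureReal_nonneg).2 (h1.trans h4) |>.trans
    (ofReal_measureReal (measure_ne_top _ _)).le

end Transfer

theorem corollary1p5
    -- the number of layers and their pairwise distinct orders of uniformity
    (d : ℕ) (hd : 1 ≤ d) (r : Fin d → ℕ) (hr : ∀ i, 2 ≤ r i) (hr_distinct : Function.Injective r)
    -- a sequence of hypermultiplexes on finite vertex sets
    (V : ℕ → Type*) [∀ n, Finite (V n)] (H : ∀ n, Hypermultiplex (V n) r)
    -- the number of colors
    (c : ℕ → ℕ) (hc : Tendsto c atTop atTop)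
    -- the uniformly random colorings, each on a probability space of its own
    (Ω : ℕ → Type*) [∀ n, MeasurableSpace (Ω n)]
    (P : ∀ n, Measure (Ω n)) [∀ n, IsProbabilityMeasure (P n)]
    (X : ∀ n, V n → Ω n → Fin (c n)) (hX : ∀ n, IsUniformRandomColoring (X n) (P n))
    -- convergence of the means and of the variances
    (rate : Fin d → ℝ≥0)
    (h_mean : ∀ i, Tendsto
      (fun n => ∫ ω, (monochromaticCount ((H n).layer i) (fun v => X n v ω) : ℝ) ∂(P n))
      atTop (𝓝 (rate i : ℝ)))
    (h_var : ∀ i, Tendsto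
      (fun n => variance
        (fun ω => (monochromaticCount ((H n).layer i) (fun v => X n v ω) : ℝ)) (P n))
      atTop (𝓝 (rate i : ℝ)))
    -- independent Poisson random variables
    (Ω' : Type*) [MeasurableSpace Ω'] (P' : Measure Ω') [IsProbabilityMeasure P']
    (Z : Fin d → Ω' → ℕ) (hZ_law : ∀ i, HasLaw (Z i) (poissonMeasure (rate i)) P')
    (hZ_indep : iIndepFun Z P') :
    TendstoInDistribution
      (fun n ω i => (monochromaticCount ((H n).layer i) (fun v => X n v ω) : ℝ))
      atTop (fun ω i => (Z i ω : ℝ)) P P' := by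
  classical
  have : ∀ n, Fintype (V n) := fun n => Fintype.ofFinite (V n)
  simp_rw [monochromaticCount_eq_monoCount] at h_mean h_var ⊢
  have hmem : ∀ n (g : (V n → Fin (c n)) → ℝ), MemLp (fun ω => g fun v => X n v ω) 2 (P n) := by
    intro n g
    obtain ⟨C, hC⟩ := (Set.finite_range fun x => ‖g x‖).bddAbove
    exact MemLp.of_bound ((measurable_of_finite g).comp
      (hX n).measurable_coloring).aestronglyMeasurable C
      (Eventually.of_forall fun ω => hC ⟨fun v => X n v ω, rfl⟩)
  have hvar : ∀ i, Tendsto (fun n => (Finset.univ.expect fun x : V n → Fin (c n) =>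
      (monoCount ((H n).layer i).edges x : ℝ) ^ 2) -
      (Finset.univ.expect fun x : V n → Fin (c n) => (monoCount ((H n).layer i).edges x : ℝ)) ^ 2) atTop
      (𝓝 (rate i : ℝ)) := by
    intro i
    refine (h_var i).congr fun n => ?_
    rw [variance_eq_sub (hmem n fun x => (monoCount ((H n).layer i).edges x : ℝ)),
      (hX n).integral_comp fun x => (monoCount ((H n).layer i).edges x : ℝ)]
    congr 1
    exact (hX n).integral_comp fun x => (monoCount ((H n).layer i).edges x : ℝ) ^ 2
  have hmean : ∀ i, Tendsto (fun n => Finset.univ.expect fun x : V n → Fin (c n) =>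
      (monoCount ((H n).layer i).edges x : ℝ)) atTop (𝓝 (rate i : ℝ)) := fun i =>
    (h_mean i).congr fun n => (hX n).integral_comp fun x =>
      (monoCount ((H n).layer i).edges x : ℝ)
  have hZ : AEMeasurable (fun ω i => Z i ω) P' :=
    aemeasurable_pi_lambda _ fun i => (hZ_law i).aemeasurable
  have hpois : ∀ k : Fin d → ℕ, (P'.map fun ω i => Z i ω).real {k} =
      ∏ i, Real.exp (-(rate i : ℝ)) * (rate i : ℝ) ^ k i / (k i).factorial := by
    intro k
    rw [(iIndepFun_iff_map_fun_eq_pi_map fun i => (hZ_law i).aemeasurable).1 hZ_indep,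
      measureReal_def, Measure.pi_singleton, ENNReal.toReal_prod]
    refine Finset.prod_congr rfl fun i _ => ?_
    rw [(hZ_law i).map_eq]
    exact poissonMeasure_real_singleton _ _
  refine tendstoInDistribution_of_eventually_le
    (T := fun n ω i => monoCount ((H n).layer i).edges fun v => X n v ω)
    (fun n => (measurable_of_finite fun (x : V n → Fin (c n)) (i : Fin d) =>
      monoCount ((H n).layer i).edges x).comp (hX n).measurable_coloring) hZ fun k ε hε => ?_
  rw [hpois]
  simp_rw [(hX _).measureReal_eq_countProb fun i => ((H _).layer i).edges]
  exact eventually_poisson_le_countProb hc hr hr_distinct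
    (fun n i e he => card_of_mem_edges ((H n).isUniform_layer i) he) (fun i => (rate i).2)
    hmean hvar k hε
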